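/- Let $n$ be a prime number and let $[n]=\{1,\dots,n\}$ be the set of identifiers of $n$ processes in the asynchronous wait-free shared-memory model: every process has a single-writer/multiple-reader register, an execution is a finite sequence $\alpha=S_1,\dots,S_k$ of subsets of $[n]$, and at step $j$ the processes of $S_j$ concurrently perform an immediate snapshot (each writes its state in its register, then reads all registers), after which each of them deterministically either updates its state or terminates with an output in $\{0,1\}$; a process that has terminated appears in no later block. Let $I$ be a set, and let $\mathcal{I}$ be a finite set of input functions $\sigma:[n]\to[n]^*\times I$, where $[n]^*$ is the set of finite (possibly empty) sequences of identifiers, and process $i$ initially knows only its identifier $i$, its input $\sigma(i)$, and the algorithm (hence $n$). For a permutation $\pi$ of $[n]$, let $\pi(\alpha)$ be the sequence $\pi(S_1),\dots,\pi(S_k)$, and let $\pi\circ\sigma\circ\pi^{-1}$ be the input function which gives to process $\pi(i)$ the input $((\pi(i_1),\dots,\pi(i_k)),x)$ whenever $\sigma(i)=((i_1,\dots,i_k),x)$. Assume that $\mathcal{I}$ is non-prime-divisible and order-invariant, i.e., that $|\mathcal{I}|$ is not divisible by $n$, and that $\pi\circ\sigma\circ\pi^{-1}\in\mathcal{I}$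 for every $\sigma\in\mathcal{I}$ and every permutation $\pi$ of $[n]$. Then there is no deterministic algorithm which, on the inputs in $\mathcal{I}$, has all of the following properties: (a) it is wait-free: for every $\sigma\in\mathcal{I}$ and every infinite scheduling, every process that is activated infinitely often terminates after finitely many steps (activations of a terminated process having no effect); (b) it is symmetric: for every $\sigma\in\mathcal{I}$, every execution $\alpha$ with input $\sigma$, with set of participating processes $P=\bigcup_j S_j$, every permutation $\pi$ of $[n]$ that is order preserving on $P$, every $i\in P$ and every $x\in\{0,1\}$, process $i$ outputs $x$ in $\alpha$ with input $\sigma$ if and only if process $\pi(i)$ outputs $x$ in $\pi(\alpha)$ with input $\pi\circ\sigma\circ\pi^{-1}$; (c) it solves weak symmetry breaking: for every $\sigma\in\mathcal{I}$, in every execution with input $\sigma$ in which all $n$ processes output, at least one process outputs $0$ and at least one process outputs $1$. (Taking $\mathcal{I}$ to be a single constant input function with the empty sequence gives the case without inputs.) -/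

import Mathlib

universe u w

namespace WaitFree

/-- An input function `σ : [n] → [n]* × I`: every process receives a finite (possibly empty)
sequence of identifiers together with a value in `I`. -/
abbrev InputFun (n : ℕ) (I : Type u) : Type u := Fin n → List (Fin n) × I

/-- Renaming the processes by `π`: process `π i` receives the input of process `i`, in which
every identifier `j` is replaced by `π j`. In short, `π ∘ σ ∘ π⁻¹`. -/
def InputFun.relabel {n : ℕ} {I : Type u} (π : Equiv.Perm (Fin n)) (σ : InputFun n I) :
    InputFun n I :=
  fun i => ((σ (π.symm i)).1.map π, (σ (π.symm i)).2)

/-- A finite set of input functions whose cardinality is not divisible by `n` when `n` is prime,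
and which is closed under renaming the processes. -/
structure NonPrimeDivisibleOrderInvariant {n : ℕ} {I : Type u} (𝓘 : Set (InputFun n I)) :
    Prop where
  finite : 𝓘.Finite
  not_dvd : n.Prime → ¬ n ∣ 𝓘.ncard
  relabel_mem : ∀ (π : Equiv.Perm (Fin n)) (σ : InputFun n I), σ ∈ 𝓘 → σ.relabel π ∈ 𝓘

/-- A deterministic algorithm with outputs in `{0, 1}` for `n` processes in shared memory.
Every process has a single-writer register which every process can read, and which is empty
(`none`) before its first write. The initial state of a process depends on its identifier and on
its input; whenever a process is activated, it writes its state in its register, reads all the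
registers, and then it either moves to a new state or terminates with an output. -/
structure Algorithm (n : ℕ) (I : Type u) where
  /-- the possible states of a process that has not terminated -/
  State : Type w
  /-- the initial state, given the identifier and the input -/
  init : Fin n → List (Fin n) × I → State
  /-- the new state (`inl`) or the output (`inr`), given the state and the registers read -/
  next : State → (Fin n → Option State) → State ⊕ Fin 2

namespace Algorithm

variable {n : ℕ} {I : Type u}

/-- A configuration: the contents of the registers, and for every process its current state
(`inl`) or, if it has terminated, its output (`inr`). -/
structure Config (A : Algorithm.{u, w} n I) where
  reg : Fin n → Option A.State
  proc : Fin n → A.State ⊕ Fin 2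

/-- The initial configuration with input function `σ`. -/
def initial (A : Algorithm.{u, w} n I) (σ : InputFun n I) : A.Config where
  reg := fun _ => none
  proc := fun i => Sum.inl (A.init i (σ i))

/-- The registers after all the non-terminated processes of the block `S` have written. -/
def written (A : Algorithm.{u, w} n I) (c : A.Config) (S : Finset (Fin n)) :
    Fin n → Option A.State :=
  fun i => if i ∈ S then (c.proc i).elim some (fun _ => c.reg i) else c.reg i

/-- One step: the processes of the block `S` concurrently perform an immediate snapshot, that is,
they all write, then they all read all the registers, and each one updates its state. Terminated
processes take no steps. -/
def step (A : Algorithm.{u, w} n I) (c : A.Config) (S : Finset (Fin n)) : A.Config where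
  reg := A.written c S
  proc := fun i =>
    if i ∈ S then (c.proc i).elim (fun s => A.next s (A.written c S)) Sum.inr else c.proc i

/-- The configuration reached with input function `σ` after the blocks of `α`. -/
def run (A : Algorithm.{u, w} n I) (σ : InputFun n I) (α : List (Finset (Fin n))) : A.Config :=
  α.foldl A.step (A.initial σ)

/-- With input function `σ`, process `i` has terminated with output `x` at the end of `α`. -/
def Outputs (A : Algorithm.{u, w} n I) (σ : InputFun n I) (α : List (Finset (Fin n)))
    (i : Fin n) (x : Fin 2) : Prop :=
  (A.run σ α).proc i = Sum.inr x

/-- `α = S₁, …, Sₖ` is an execution with input function `σ`: no process appears in a block after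
it has terminated. -/
def IsExecution (A : Algorithm.{u, w} n I) (σ : InputFun n I) (α : List (Finset (Fin n))) :
    Prop :=
  ∀ (β γ : List (Finset (Fin n))) (S : Finset (Fin n)), α = β ++ S :: γ →
    ∀ i ∈ S, ∀ x, ¬ A.Outputs σ β i x

/-- Wait-freedom on the inputs in `𝓘`: under every scheduling, every process that is activated
infinitely often terminates after finitely many steps. -/
def IsWaitFree (A : Algorithm.{u, w} n I) (𝓘 : Set (InputFun n I)) : Prop :=
  ∀ σ ∈ 𝓘, ∀ (S : ℕ → Finset (Fin n)) (i : Fin n), (∀ m, ∃ k, m ≤ k ∧ i ∈ S k) →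
    ∃ k x, A.Outputs σ ((List.range k).map S) i x

end Algorithm

/-- The participating set of `α`. -/
def participants {n : ℕ} (α : List (Finset (Fin n))) : Set (Fin n) :=
  {i | ∃ S ∈ α, i ∈ S}

/-- `π(α)`: every occurrence of `i` in a block of `α` is replaced by `π i`. -/
def permute {n : ℕ} (π : Equiv.Perm (Fin n)) (α : List (Finset (Fin n))) :
    List (Finset (Fin n)) :=
  α.map fun S => S.map π.toEmbedding

namespace Algorithm

variable {n : ℕ} {I : Type u}

/-- Symmetry on the inputs in `𝓘`: for every execution `α` and every permutation `π` which is
order preserving on the participating set of `α`, a participating process `i` outputs `x` in `α`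
if and only if `π i` outputs `x` in `π(α)`, the inputs being renamed by `π` as well. -/
def IsSymmetric (A : Algorithm.{u, w} n I) (𝓘 : Set (InputFun n I)) : Prop :=
  ∀ σ ∈ 𝓘, ∀ α : List (Finset (Fin n)), A.IsExecution σ α →
    ∀ π : Equiv.Perm (Fin n), StrictMonoOn π (participants α) →
      ∀ i ∈ participants α, ∀ x,
        A.Outputs σ α i x ↔ A.Outputs (σ.relabel π) (permute π α) (π i) x

/-- Weak symmetry breaking on the inputs in `𝓘`: in every execution in which all the processes
output, at least one outputs `0` and at least one outputs `1`. -/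
def SolvesWSB (A : Algorithm.{u, w} n I) (𝓘 : Set (InputFun n I)) : Prop :=
  ∀ σ ∈ 𝓘, ∀ α : List (Finset (Fin n)), A.IsExecution σ α →
    (∀ i, ∃ x, A.Outputs σ α i x) → (∃ i, A.Outputs σ α i 0) ∧ ∃ i, A.Outputs σ α i 1

end Algorithm

end WaitFree

namespace WaitFree.Algorithm

open Finset

variable {n : ℕ} {I : Type u} {A : Algorithm.{u, w} n I}

/-! Suppose an algorithm exists. Let `T m j` be the sum, over all inputs, of the signed number of
complete executions of the first `m` processes in which the first `j` of them output `1` and the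
other `m - j` output `0`. The proof computes `T` modulo `n`.

The sign makes one process removable: if an outcome does not depend on the output of `i`, the
executions of `P` in which another process sees `i` cancel in pairs, leaving the count for `P.erase
i` (`StepBound.signedCount_erase`). Ignoring the output of process `j` adds `T (m + 1) j` to `T (m +
1) (j + 1)`. Removing that process and closing the gap by an order-preserving renaming, which
symmetry allows and which permutes the inputs, gives `T (m + 1) j + T (m + 1) (j + 1) = T m j`
(`thresholdCount_add`).

By this recurrence `T n n` is the alternating sum of the `T i 0` with coefficients `n.choose i`;
modulo the prime `n` only the terms `T 0 0` and `± T n 0` survive. Weak symmetry breaking forces `T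
n 0 = T n n = 0`, while `T 0 0` is the number of inputs. So `n` divides that number, a
contradiction. Wait-freedom bounds the length of executions, so that all sums are finite. -/

/-- The processes that have not terminated. -/
def Config.alive (c : A.Config) : Finset (Fin n) :=
  univ.filter fun i => (c.proc i).isLeft

theorem Config.mem_alive {c : A.Config} {i : Fin n} :
    i ∈ c.alive ↔ ∀ x, c.proc i ≠ Sum.inr x := by
  cases h : c.proc i <;> simp [Config.alive, h]

/-- Every sequence of nonempty blocks of non-terminated processes, starting in `c`, has at most
`k` blocks. -/
def StepBound : ℕ → A.Config → Prop
  | 0, c => c.alive = ∅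
  | k + 1, c => ∀ S ⊆ c.alive, S.Nonempty → StepBound k (A.step c S)

/-- The sum of `g` over all the executions which start in `c` and in which exactly the processes of
`P` run until they all terminate, where an execution with the blocks `S₁, …, Sₘ` is counted with
the sign `∏ (-1) ^ (|Sⱼ| + 1)`. The recursion is cut off at depth `k`. -/
def signedCount (P : Finset (Fin n)) (g : (Fin n → A.State ⊕ Fin 2) → ℤ) : ℕ → A.Config → ℤ
  | 0, c => g c.proc
  | k + 1, c =>
    if c.alive ∩ P = ∅ then g c.proc
    else ∑ S ∈ (c.alive ∩ P).powerset.erase ∅, (-1) ^ (#S + 1) * signedCount P g k (A.step c S)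

/-! ### Local effect of a block on the configuration -/

section Step

variable {c : A.Config} {S : Finset (Fin n)} {i : Fin n}

theorem step_proc_of_notMem (h : i ∉ S) : (A.step c S).proc i = c.proc i := by
  simp [step, h]

theorem step_proc_of_inr {x : Fin 2} (h : c.proc i = Sum.inr x) :
    (A.step c S).proc i = Sum.inr x := by
  simp [step, h]

/-- All writes of a block precede its reads, so the others cannot tell whether `i` moved just before
them or together with them. This is the source of the cancellation. -/
theorem step_insert_reg (hS : i ∉ S) :
    (A.step c (insert i S)).reg = (A.step (A.step c {i}) S).reg := by
  funext j
  by_cases hj : j = i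
  · subst hj
    simp [step, written, hS]
  · simp [step, written, hj]

theorem step_insert_proc (hS : i ∉ S) {j : Fin n} (hj : j ≠ i) :
    (A.step c (insert i S)).proc j = (A.step (A.step c {i}) S).proc j := by
  have h : A.written c (insert i S) = A.written (A.step c {i}) S := step_insert_reg hS
  have h' : (A.step c {i}).proc j = c.proc j := step_proc_of_notMem (by simpa using hj)
  have e1 : (A.step c (insert i S)).proc j = if j ∈ insert i S then
      (c.proc j).elim (fun s => A.next s (A.written c (insert i S))) Sum.inr else c.proc j := rfl
  have e2 : (A.step (A.step c {i}) S).proc j = if j ∈ S then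
      ((A.step c {i}).proc j).elim (fun s => A.next s (A.written (A.step c {i}) S)) Sum.inr
      else (A.step c {i}).proc j := rfl
  rw [e1, e2, h, h']
  simp [hj]

theorem step_reg_congr {c' : A.Config} (hreg : c.reg = c'.reg)
    (hproc : ∀ j ≠ i, c.proc j = c'.proc j) (hS : i ∉ S) :
    (A.step c S).reg = (A.step c' S).reg := by
  funext j
  by_cases hj : j ∈ S
  · have : j ≠ i := fun h => hS (h ▸ hj)
    simp [step, written, hj, hproc j this, hreg]
  · simp [step, written, hj, hreg]

theorem step_proc_congr {c' : A.Config} (hreg : c.reg = c'.reg)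
    (hproc : ∀ j ≠ i, c.proc j = c'.proc j) (hS : i ∉ S) :
    ∀ j ≠ i, (A.step c S).proc j = (A.step c' S).proc j := by
  intro j hj
  have h : A.written c S = A.written c' S := step_reg_congr hreg hproc hS
  simp [step, h, hproc j hj]

end Step

/-! ### Signed counts and removal of a process -/

section SignedCount

variable {P : Finset (Fin n)} {g g₁ g₂ : (Fin n → A.State ⊕ Fin 2) → ℤ} {i : Fin n}

theorem signedCount_of_inter_eq_empty {c : A.Config} (h : c.alive ∩ P = ∅) (k : ℕ) :
    signedCount P g k c = g c.proc := by
  cases k <;> simp [signedCount, h]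

theorem signedCount_succ {c : A.Config} (h : c.alive ∩ P ≠ ∅) (k : ℕ) :
    signedCount P g (k + 1) c = ∑ S ∈ (c.alive ∩ P).powerset.erase ∅,
      (-1) ^ (#S + 1) * signedCount P g k (A.step c S) := by
  simp [signedCount, h]

theorem mem_blocks {c : A.Config} {S : Finset (Fin n)}
    (hS : S ∈ (c.alive ∩ P).powerset.erase ∅) : S ⊆ c.alive ∧ S ⊆ P ∧ S.Nonempty := by
  rw [mem_erase, mem_powerset, subset_inter_iff] at hS
  exact ⟨hS.2.1, hS.2.2, nonempty_iff_ne_empty.2 hS.1⟩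

theorem StepBound.succ {k : ℕ} {c : A.Config} (h : StepBound k c) : StepBound (k + 1) c := by
  induction k generalizing c with
  | zero =>
    intro S hS hne
    rw [show c.alive = ∅ from h, subset_empty] at hS
    exact absurd hS hne.ne_empty
  | succ k ih => exact fun S hS hne => ih (h S hS hne)

theorem StepBound.mono {k l : ℕ} {c : A.Config} (hkl : k ≤ l) (h : StepBound k c) :
    StepBound l c := by
  induction hkl with
  | refl => exact h
  | step _ ih => exact ih.succ

theorem StepBound.signedCount_succ_eq {k : ℕ} {c : A.Config} (h : StepBound k c) :
    signedCount P g (k + 1) c = signedCount P g k c := by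
  induction k generalizing c with
  | zero =>
    have h : c.alive = ∅ := h
    rw [signedCount_of_inter_eq_empty (by simp [h]), signedCount_of_inter_eq_empty (by simp [h])]
  | succ k ih =>
    by_cases hP : c.alive ∩ P = ∅
    · rw [signedCount_of_inter_eq_empty hP, signedCount_of_inter_eq_empty hP]
    · rw [signedCount_succ hP, signedCount_succ hP]
      refine sum_congr rfl fun S hS => ?_
      obtain ⟨h1, -, h3⟩ := mem_blocks hS
      rw [ih (h S h1 h3)]

/-- The depth bound ensures that `g` is evaluated only after all of `P` has terminated, so the
identity is needed only there. -/
theorem StepBound.signedCount_add {g' : (Fin n → A.State ⊕ Fin 2) → ℤ}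
    (hg : ∀ p : Fin n → A.State ⊕ Fin 2, (∀ i ∈ P, ∃ x, p i = Sum.inr x) → g₁ p + g₂ p = g' p)
    {k : ℕ} {c : A.Config} (h : StepBound k c) :
    signedCount P g₁ k c + signedCount P g₂ k c = signedCount P g' k c := by
  have leaf : ∀ c : A.Config, c.alive ∩ P = ∅ → g₁ c.proc + g₂ c.proc = g' c.proc := by
    intro c hc
    refine hg _ fun i hi => ?_
    by_contra! hx
    exact notMem_empty i (hc ▸ mem_inter.2 ⟨Config.mem_alive.2 hx, hi⟩)
  induction k generalizing c with
  | zero =>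
    have h : c.alive = ∅ := h
    exact leaf c (by simp [h])
  | succ k ih =>
    by_cases hP : c.alive ∩ P = ∅
    · simp only [signedCount_of_inter_eq_empty hP, leaf c hP]
    · simp only [signedCount_succ hP, ← sum_add_distrib, ← mul_add]
      refine sum_congr rfl fun S hS => ?_
      obtain ⟨h1, -, h3⟩ := mem_blocks hS
      rw [ih (h S h1 h3)]

theorem inter_alive_congr {c c' : A.Config} (hi : i ∉ P) (hproc : ∀ j ≠ i, c.proc j = c'.proc j) :
    c.alive ∩ P = c'.alive ∩ P := by
  ext j
  simp only [mem_inter, Config.mem_alive]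
  refine and_congr_left fun hj => ?_
  rw [hproc j fun h => hi (h ▸ hj)]

/-- A process outside `P` never moves again, so it influences the others only through its register.
-/
theorem signedCount_congr (hi : i ∉ P)
    (hg : ∀ p p' : Fin n → A.State ⊕ Fin 2, (∀ j ≠ i, p j = p' j) → g p = g p') {k : ℕ}
    {c c' : A.Config} (hreg : c.reg = c'.reg) (hproc : ∀ j ≠ i, c.proc j = c'.proc j) :
    signedCount P g k c = signedCount P g k c' := by
  induction k generalizing c c' with
  | zero => exact hg _ _ hproc
  | succ k ih =>
    have hA := inter_alive_congr hi hproc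
    by_cases hP : c.alive ∩ P = ∅
    · rw [signedCount_of_inter_eq_empty hP, signedCount_of_inter_eq_empty (hA ▸ hP)]
      exact hg _ _ hproc
    · rw [signedCount_succ hP, signedCount_succ (hA ▸ hP), ← hA]
      refine sum_congr rfl fun S hS => ?_
      have hiS : i ∉ S := fun h => hi ((mem_blocks hS).2.1 h)
      rw [ih (step_reg_congr hreg hproc hiS) (step_proc_congr hreg hproc hiS)]

/-- The executions in which `i` is seen by some other process cancel out in pairs, according to
whether the last step of `i` which is seen is simultaneous with the next one of the others. -/
theorem StepBound.signedCount_erase (hi : i ∈ P)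
    (hg : ∀ p p' : Fin n → A.State ⊕ Fin 2, (∀ j ≠ i, p j = p' j) → g p = g p') {k : ℕ}
    {c : A.Config} (h : StepBound k c) :
    signedCount P g k c = signedCount (P.erase i) g k c := by
  induction k generalizing c with
  | zero => rfl
  | succ k ih =>
    by_cases hc : i ∈ c.alive
    swap
    · have hA : c.alive ∩ P.erase i = c.alive ∩ P := by
        rw [← erase_inter_comm, erase_eq_of_notMem hc]
      by_cases hP : c.alive ∩ P = ∅
      · rw [signedCount_of_inter_eq_empty hP, signedCount_of_inter_eq_empty (hA.trans hP)]
      · rw [signedCount_succ hP, signedCount_succ (hA ▸ hP), hA]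
        refine sum_congr rfl fun S hS => ?_
        obtain ⟨h1, -, h3⟩ := mem_blocks hS
        rw [ih (h S h1 h3)]
    have hA : c.alive ∩ P = insert i (c.alive ∩ P.erase i) := by
      rw [inter_erase, insert_erase (mem_inter.2 ⟨hc, hi⟩)]
    have hP : c.alive ∩ P ≠ ∅ := by simp [hA]
    have hiA : i ∉ c.alive ∩ P.erase i := by simp
    have hne : ∀ j ≠ i, (A.step c {i}).proc j = c.proc j :=
      fun j hj => step_proc_of_notMem (by simpa using hj)
    have hA' : (A.step c {i}).alive ∩ P.erase i = c.alive ∩ P.erase i :=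
      inter_alive_congr (notMem_erase i P) hne
    have hB : StepBound k (A.step c {i}) :=
      h {i} (singleton_subset_iff.2 hc) (singleton_nonempty i)
    have hsum : signedCount P g (k + 1) c = ∑ S ∈ (c.alive ∩ P).powerset.erase ∅,
        (-1) ^ (#S + 1) * signedCount (P.erase i) g k (A.step c S) := by
      rw [signedCount_succ hP]
      refine sum_congr rfl fun S hS => ?_
      obtain ⟨h1, -, h3⟩ := mem_blocks hS
      rw [ih (h S h1 h3)]
    -- The first blocks split into three kinds: nonempty `S` without `i`, the block `{i}` alone, and
    -- `insert i S` with `S` nonempty. The last two kinds will cancel.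
    rw [hsum, sum_erase_eq_sub (empty_mem_powerset _), hA, sum_powerset_insert hiA,
      add_sub_right_comm, ← sum_erase_eq_sub (empty_mem_powerset _),
      ← add_sum_erase _ (fun S => (-1) ^ (#(insert i S) + 1) *
        signedCount (P.erase i) g k (A.step c (insert i S))) (empty_mem_powerset _)]
    have hins : ∀ S ∈ (c.alive ∩ P.erase i).powerset.erase ∅,
        (-1) ^ (#(insert i S) + 1) * signedCount (P.erase i) g k (A.step c (insert i S)) =
        -((-1) ^ (#S + 1) * signedCount (P.erase i) g k (A.step (A.step c {i}) S)) := by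
      intro S hS
      have hiS : i ∉ S := fun h' => notMem_erase i P ((mem_blocks hS).2.1 h')
      rw [card_insert_of_notMem hiS, signedCount_congr (notMem_erase i P) hg
        (step_insert_reg hiS) (fun j hj => step_insert_proc hiS hj)]
      ring
    rw [sum_congr rfl hins, sum_neg_distrib]
    by_cases hP' : c.alive ∩ P.erase i = ∅
    · rw [signedCount_of_inter_eq_empty hP', hP']
      simp [signedCount_of_inter_eq_empty (hA'.trans hP'), hg _ _ hne]
    · have := signedCount_succ (g := g) (c := A.step c {i}) (hA' ▸ hP') k
      -- Running `{i}` and then `S` takes one block more than `insert i S`; the depth bound absorbs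
      -- the difference.
      rw [hB.signedCount_succ_eq, hA'] at this
      rw [← this, signedCount_succ hP']
      simp

end SignedCount

/-! ### Executions, termination bounds and symmetry -/

section Run

variable {𝓘 : Set (InputFun n I)} {σ : InputFun n I} {α : List (Finset (Fin n))}
  {S : Finset (Fin n)} {i : Fin n}

theorem run_append_singleton : A.run σ (α ++ [S]) = A.step (A.run σ α) S := by
  simp [run]

theorem run_proc_of_notMem (h : i ∉ participants α) :
    (A.run σ α).proc i = Sum.inl (A.init i (σ i)) := by
  induction α using List.reverseRecOn with
  | nil => rfl
  | append_singleton α S ih =>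
    rw [run_append_singleton, step_proc_of_notMem fun hi => h ⟨S, by simp, hi⟩]
    exact ih fun ⟨T, hT, hi⟩ => h ⟨T, by simp [hT], hi⟩

theorem IsExecution.append_singleton (h : A.IsExecution σ α) (hS : S ⊆ (A.run σ α).alive) :
    A.IsExecution σ (α ++ [S]) := by
  intro β γ T hα i hi x
  rcases List.eq_nil_or_concat γ with rfl | ⟨γ, U, rfl⟩
  · obtain ⟨rfl, hST⟩ := List.append_inj' hα rfl
    obtain rfl : S = T := by simpa using hST
    exact Config.mem_alive.1 (hS hi) x
  · have hα' : α ++ [S] = (β ++ T :: γ) ++ [U] := by simpa using hα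
    obtain ⟨h1, -⟩ := List.append_inj' hα' rfl
    exact h β γ T h1 i hi x

theorem participants_append_singleton_subset {P : Finset (Fin n)} (h : participants α ⊆ P)
    (hS : S ⊆ P) : participants (α ++ [S]) ⊆ P := by
  rintro i ⟨T, hT, hi⟩
  rcases List.mem_append.1 hT with hT | hT
  · exact h ⟨T, hT, hi⟩
  · obtain rfl := List.mem_singleton.1 hT
    exact hS hi

theorem isExecution_nil : A.IsExecution σ [] := by
  intro β γ S h
  simp at h

theorem participants_nil : participants ([] : List (Finset (Fin n))) = ∅ := by
  simp [participants]

/-- König's lemma: each configuration has finitely many possible blocks, so the maximum of the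
bounds of its successors works. -/
theorem exists_stepBound_of_acc {c : A.Config}
    (h : Acc (fun c' c : A.Config => ∃ S ⊆ c.alive, S.Nonempty ∧ c' = A.step c S) c) :
    ∃ k, StepBound k c := by
  induction h with
  | intro c _ ih =>
    have hS : ∀ S : Finset (Fin n), ∃ k, S ⊆ c.alive → S.Nonempty → StepBound k (A.step c S) := by
      intro S
      by_cases h : S ⊆ c.alive ∧ S.Nonempty
      · obtain ⟨k, hk⟩ := ih _ ⟨S, h.1, h.2, rfl⟩
        exact ⟨k, fun _ _ => hk⟩
      · exact ⟨0, fun h1 h2 => absurd ⟨h1, h2⟩ h⟩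
    choose k hk using hS
    exact ⟨univ.sup k + 1, fun S h1 h2 => (hk S h1 h2).mono (le_sup (mem_univ S))⟩

theorem IsWaitFree.exists_stepBound (hA : A.IsWaitFree 𝓘) (hσ : σ ∈ 𝓘) :
    ∃ k, StepBound k (A.initial σ) := by
  refine exists_stepBound_of_acc (acc_iff_isEmpty_descending_chain.2 ⟨?_⟩)
  rintro ⟨f, h0, hf⟩
  choose S hS hne hstep using hf
  have hrun : ∀ k, A.run σ ((List.range k).map S) = f k := by
    intro k
    induction k with
    | zero => exact h0.symm
    | succ k ih => rw [List.range_succ, List.map_append, List.map_singleton,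
        run_append_singleton, ih, hstep]
  -- By pigeonhole, some process moves infinitely often in an infinite run; it must terminate, yet
  -- it appears in later blocks of live processes.
  choose p hp using hne
  obtain ⟨i, hi⟩ := Finite.exists_infinite_fiber p
  have hfreq : ∀ m, ∃ k, m ≤ k ∧ i ∈ S k := by
    intro m
    obtain ⟨k, hk, hmk⟩ := (Set.infinite_coe_iff.1 hi).exists_gt m
    exact ⟨k, hmk.le, by simpa [← (show p k = i from hk)] using hp k⟩
  obtain ⟨k, x, hk⟩ := hA σ hσ S i hfreq
  obtain ⟨l, hkl, hl⟩ := hfreq k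
  have hout : ∀ l, k ≤ l → (f l).proc i = Sum.inr x := by
    intro l hkl
    induction hkl with
    | refl => rw [← hrun]; exact hk
    | step _ ih => rw [hstep]; exact step_proc_of_inr ih
  exact Config.mem_alive.1 (hS l hl) x (hout l hkl)

/-- Symmetry speaks of participants only; a process that has not participated has no output on
either side. -/
theorem IsSymmetric.proc_eq_inr_iff (hA : A.IsSymmetric 𝓘) (hσ : σ ∈ 𝓘)
    (hα : A.IsExecution σ α) {P : Finset (Fin n)} (hP : participants α ⊆ P)
    {π : Equiv.Perm (Fin n)} (hπ : StrictMonoOn π P) (i : Fin n) (x : Fin 2) :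
    (A.run σ α).proc i = Sum.inr x ↔
      (A.run (σ.relabel π) (permute π α)).proc (π i) = Sum.inr x := by
  by_cases hi : i ∈ participants α
  · exact hA σ hσ α hα π (hπ.mono hP) i hi x
  · have hi' : π i ∉ participants (permute π α) := by
      rintro ⟨T, hT, hiT⟩
      obtain ⟨S, hS, rfl⟩ := List.mem_map.1 hT
      exact hi ⟨S, hS, by simpa using hiT⟩
    simp [run_proc_of_notMem hi, run_proc_of_notMem hi']

/-- Renaming is a bijection between the executions, and it preserves block sizes, hence signs. -/
theorem IsSymmetric.signedCount_relabel (hA : A.IsSymmetric 𝓘) (hσ : σ ∈ 𝓘)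
    {P : Finset (Fin n)} {π : Equiv.Perm (Fin n)} (hπ : StrictMonoOn π P)
    {g g' : (Fin n → A.State ⊕ Fin 2) → ℤ}
    (hg : ∀ p p' : Fin n → A.State ⊕ Fin 2,
      (∀ i ∈ P, ∀ x, p i = Sum.inr x ↔ p' (π i) = Sum.inr x) → g p = g' p')
    (k : ℕ) :
    signedCount P g k (A.initial σ) =
      signedCount (P.map π.toEmbedding) g' k (A.initial (σ.relabel π)) := by
  suffices H : ∀ α : List (Finset (Fin n)), A.IsExecution σ α → participants α ⊆ P →
      signedCount P g k (A.run σ α) = signedCount (P.map π.toEmbedding) g' k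
        (A.run (σ.relabel π) (permute π α)) from
    H [] isExecution_nil (by simp [participants_nil])
  induction k with
  | zero => exact fun α hα hP => hg _ _ fun i _ x => hA.proc_eq_inr_iff hσ hα hP hπ i x
  | succ k ih =>
    intro α hα hP
    have hiff := hA.proc_eq_inr_iff hσ hα hP hπ
    have hmap : (A.run (σ.relabel π) (permute π α)).alive ∩ P.map π.toEmbedding =
        ((A.run σ α).alive ∩ P).map π.toEmbedding := by
      ext j
      obtain ⟨i, rfl⟩ := π.surjective j
      simp [Config.mem_alive, hiff]
    by_cases he : (A.run σ α).alive ∩ P = ∅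
    · rw [signedCount_of_inter_eq_empty he, signedCount_of_inter_eq_empty (by simp [hmap, he])]
      exact hg _ _ fun i _ x => hiff i x
    · rw [signedCount_succ he, signedCount_succ (by simpa [hmap] using he), hmap]
      refine sum_bij (fun S _ => S.map π.toEmbedding) (fun S hS => ?_)
        (fun S _ T _ h => map_injective _ h) (fun T hT => ?_) (fun S hS => ?_)
      · rw [mem_erase, mem_powerset] at hS ⊢
        exact ⟨by simpa using hS.1, map_subset_map.2 hS.2⟩
      · obtain ⟨hT0, hT⟩ := mem_erase.1 hT
        obtain ⟨S, hS, rfl⟩ := subset_map_iff.1 (mem_powerset.1 hT)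
        exact ⟨S, mem_erase.2 ⟨by simpa using hT0, mem_powerset.2 hS⟩, rfl⟩
      · obtain ⟨h1, h2, -⟩ := mem_blocks hS
        have := ih (α ++ [S]) (hα.append_singleton h1) (participants_append_singleton_subset hP h2)
        rw [run_append_singleton] at this
        rw [card_map, this]
        simp [permute, run_append_singleton]

theorem StepBound.signedCount_eq_zero {g : (Fin n → A.State ⊕ Fin 2) → ℤ} {k : ℕ}
    (hk : StepBound k (A.initial σ))
    (hg : ∀ α, A.IsExecution σ α → (∀ i, ∃ x, A.Outputs σ α i x) → g (A.run σ α).proc = 0) :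
    signedCount univ g k (A.initial σ) = 0 := by
  suffices H : ∀ α : List (Finset (Fin n)), A.IsExecution σ α → StepBound k (A.run σ α) →
      signedCount univ g k (A.run σ α) = 0 from H [] isExecution_nil hk
  clear hk
  have leaf : ∀ α, A.IsExecution σ α → (A.run σ α).alive = ∅ → g (A.run σ α).proc = 0 := by
    refine fun α hα h => hg α hα fun i => ?_
    by_contra! hx
    exact notMem_empty i (h ▸ Config.mem_alive.2 hx)
  induction k with
  | zero => exact fun α hα h => leaf α hα h
  | succ k ih =>
    intro α hα h
    by_cases he : (A.run σ α).alive ∩ univ = ∅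
    · rw [signedCount_of_inter_eq_empty he]
      exact leaf α hα (by simpa using he)
    · rw [signedCount_succ he]
      refine sum_eq_zero fun S hS => ?_
      obtain ⟨h1, -, h3⟩ := mem_blocks hS
      rw [← run_append_singleton, ih _ (hα.append_singleton h1), mul_zero]
      rw [run_append_singleton]
      exact h S h1 h3

end Run

/-! ### Threshold outcomes and their recurrence -/

section Outcome

open Classical in
/-- The indicator function of the outcomes in which the processes `i ∈ P` output `1` for `i < j`
and `0` for `i ≥ j`. -/
noncomputable def thresholdIndicator (A : Algorithm.{u, w} n I) (P : Finset (Fin n)) (j : ℕ)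
    (p : Fin n → A.State ⊕ Fin 2) : ℤ :=
  if ∀ i ∈ P, p i = Sum.inr (if i.val < j then 1 else 0) then 1 else 0

/-- The signed number of executions of the first `m` processes in which the first `j` of them
output `1` and the others output `0`. -/
noncomputable def thresholdCount (A : Algorithm.{u, w} n I) (𝓙 : Finset (InputFun n I))
    (k m j : ℕ) : ℤ :=
  ∑ σ ∈ 𝓙, signedCount (univ.filter fun i : Fin n => i.val < m)
    (A.thresholdIndicator (univ.filter fun i : Fin n => i.val < m) j) k (A.initial σ)

/-- The permutation which moves `j` to the place `m` and keeps the order of the other places up to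
`m`. -/
theorem exists_perm_val_eq {m j : ℕ} (hm : m < n) (hj : j ≤ m) :
    ∃ π : Equiv.Perm (Fin n), ∀ i : Fin n, (π i).val =
      if i.val < j then i.val else if i.val = j then m else if i.val ≤ m then i.val - 1 else i := by
  let f : Fin n → Fin n := fun i => ⟨if i.val < j then i.val else if i.val = j then m else
    if i.val ≤ m then i.val - 1 else i, by split_ifs <;> omega⟩
  have hf : Function.Injective f := by
    intro a b hab
    have : (f a).val = (f b).val := congrArg Fin.val hab
    simp only [f] at this
    ext
    split_ifs at this <;> omega
  exact ⟨Equiv.ofBijective f (Finite.injective_iff_bijective.1 hf), fun i => rfl⟩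

theorem thresholdIndicator_congr {P : Finset (Fin n)} {j : ℕ} {i : Fin n} (hi : i ∉ P)
    {p p' : Fin n → A.State ⊕ Fin 2} (h : ∀ l ≠ i, p l = p' l) :
    A.thresholdIndicator P j p = A.thresholdIndicator P j p' := by
  have : (∀ l ∈ P, p l = Sum.inr (if l.val < j then 1 else 0)) ↔
      ∀ l ∈ P, p' l = Sum.inr (if l.val < j then 1 else 0) :=
    forall₂_congr fun l hl => by rw [h l fun e => hi (e ▸ hl)]
  classical exact if_congr this rfl rfl

theorem thresholdIndicator_map {P : Finset (Fin n)} {j : ℕ} {π : Equiv.Perm (Fin n)}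
    (hπ : ∀ i ∈ P, (π i).val < j ↔ i.val < j) {p p' : Fin n → A.State ⊕ Fin 2}
    (h : ∀ i ∈ P, ∀ x, p i = Sum.inr x ↔ p' (π i) = Sum.inr x) :
    A.thresholdIndicator P j p = A.thresholdIndicator (P.map π.toEmbedding) j p' := by
  have : (∀ i ∈ P, p i = Sum.inr (if i.val < j then 1 else 0)) ↔
      ∀ i ∈ P.map π.toEmbedding, p' i = Sum.inr (if i.val < j then 1 else 0) := by
    rw [forall_mem_map]
    refine forall₂_congr fun i hi => ?_
    rw [h i hi]
    simp [hπ i hi]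
  classical exact if_congr this rfl rfl

/-- The thresholds `j` and `j + 1` differ only in the output required of process `j`, and its actual
output meets exactly one of the two. -/
theorem thresholdIndicator_add {P : Finset (Fin n)} {j : Fin n} (hj : j ∈ P)
    {p : Fin n → A.State ⊕ Fin 2} (hp : ∃ x, p j = Sum.inr x) :
    A.thresholdIndicator P j p + A.thresholdIndicator P (j + 1) p =
      A.thresholdIndicator (P.erase j) j p := by
  obtain ⟨x, hx⟩ := hp
  have h0 : (∀ i ∈ P, p i = Sum.inr (if i.val < j then 1 else 0)) ↔
      x = 0 ∧ ∀ i ∈ P.erase j, p i = Sum.inr (if i.val < j then 1 else 0) := by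
    conv_lhs => rw [← insert_erase hj, forall_mem_insert]
    simp [hx]
  have h1 : (∀ i ∈ P, p i = Sum.inr (if i.val < j + 1 then 1 else 0)) ↔
      x = 1 ∧ ∀ i ∈ P.erase j, p i = Sum.inr (if i.val < j then 1 else 0) := by
    conv_lhs => rw [← insert_erase hj, forall_mem_insert]
    have : ∀ i ∈ P.erase j, (i.val < j + 1 ↔ i.val < j) := by
      intro i hi
      have : i.val ≠ j := fun h => ne_of_mem_erase hi (Fin.ext h)
      omega
    rw [hx]
    refine and_congr (by simp) (forall₂_congr fun i hi => ?_)
    simp only [this i hi]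
  classical
  rw [thresholdIndicator, thresholdIndicator, thresholdIndicator, if_congr h0 rfl rfl,
    if_congr h1 rfl rfl]
  fin_cases x <;> simp

theorem relabel_symm_relabel (π : Equiv.Perm (Fin n)) (σ : InputFun n I) :
    (σ.relabel π).relabel π.symm = σ := by
  funext i
  simp [InputFun.relabel]

theorem thresholdCount_add {𝓙 : Finset (InputFun n I)} (hA : A.IsSymmetric (𝓙 : Set (InputFun n I)))
    (h𝓙 : ∀ (π : Equiv.Perm (Fin n)), ∀ σ ∈ 𝓙, σ.relabel π ∈ 𝓙) {k : ℕ}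
    (hk : ∀ σ ∈ 𝓙, StepBound k (A.initial σ)) {m j : ℕ} (hm : m < n) (hj : j ≤ m) :
    A.thresholdCount 𝓙 k (m + 1) j + A.thresholdCount 𝓙 k (m + 1) (j + 1) =
      A.thresholdCount 𝓙 k m j := by
  obtain ⟨π, hπ⟩ := exists_perm_val_eq hm hj
  set P : Finset (Fin n) := univ.filter fun i : Fin n => i.val < m + 1 with hP
  let j' : Fin n := ⟨j, hj.trans_lt hm⟩
  have hjP : j' ∈ P := by simp [hP, j', hj]
  have hval : ∀ i ∈ P.erase j', i.val ≤ m ∧ i.val ≠ j := by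
    intro i hi
    obtain ⟨h1, h2⟩ := mem_erase.1 hi
    simp only [hP, mem_filter, mem_univ, true_and] at h2
    exact ⟨by omega, fun h => h1 (Fin.ext h)⟩
  have hmap : (P.erase j').map π.toEmbedding = univ.filter fun i : Fin n => i.val < m := by
    ext l
    obtain ⟨i, rfl⟩ := π.surjective l
    simp only [mem_map_equiv, Equiv.symm_apply_apply, mem_filter, mem_univ, true_and, hπ,
      mem_erase, hP, ne_eq, Fin.ext_iff, j']
    split_ifs <;> omega
  have hmono : StrictMonoOn π (P.erase j' : Finset (Fin n)) := by
    intro a ha b hb hab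
    have ha := hval a ha
    have hb := hval b hb
    rw [Fin.lt_def] at hab ⊢
    rw [hπ, hπ]
    split_ifs <;> omega
  have hlt : ∀ i ∈ P.erase j', (π i).val < j ↔ i.val < j := by
    intro i hi
    have := hval i hi
    rw [hπ]
    split_ifs <;> omega
  have key : ∀ σ ∈ 𝓙, signedCount P (A.thresholdIndicator P j) k (A.initial σ) +
      signedCount P (A.thresholdIndicator P (j + 1)) k (A.initial σ) =
      signedCount (univ.filter fun i : Fin n => i.val < m)
        (A.thresholdIndicator (univ.filter fun i : Fin n => i.val < m) j) k
        (A.initial (σ.relabel π)) := by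
    intro σ hσ
    rw [(hk σ hσ).signedCount_add (g' := A.thresholdIndicator (P.erase j') j)
        (fun p hp => thresholdIndicator_add hjP (hp _ hjP)),
      (hk σ hσ).signedCount_erase hjP
        (fun p p' h => thresholdIndicator_congr (notMem_erase j' P) h),
      hA.signedCount_relabel hσ hmono (fun p p' h => thresholdIndicator_map hlt h), hmap]
  rw [thresholdCount, thresholdCount, ← hP, ← sum_add_distrib, sum_congr rfl key]
  -- Renaming changes the input, so the recurrence holds only after summing over the order-invariant
  -- set.
  exact sum_nbij' (fun σ => σ.relabel π) (fun σ => σ.relabel π.symm) (fun σ hσ => h𝓙 _ σ hσ)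
    (fun σ hσ => h𝓙 _ σ hσ) (fun σ _ => relabel_symm_relabel π σ)
    (fun σ _ => relabel_symm_relabel π.symm σ) (fun σ _ => rfl)

theorem thresholdCount_zero (𝓙 : Finset (InputFun n I)) (k : ℕ) :
    A.thresholdCount 𝓙 k 0 0 = #𝓙 := by
  simp [thresholdCount, signedCount_of_inter_eq_empty, thresholdIndicator]

theorem thresholdCount_eq_zero {𝓙 : Finset (InputFun n I)}
    (hA : A.SolvesWSB (𝓙 : Set (InputFun n I))) {k : ℕ}
    (hk : ∀ σ ∈ 𝓙, StepBound k (A.initial σ)) {j : ℕ} (hj : j = 0 ∨ j = n) :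
    A.thresholdCount 𝓙 k n j = 0 := by
  refine sum_eq_zero fun σ hσ => ?_
  have huniv : (univ.filter fun i : Fin n => i.val < n) = univ := by simp
  rw [huniv]
  refine (hk σ hσ).signedCount_eq_zero fun α hα hout => if_neg fun h => ?_
  obtain ⟨⟨a, ha⟩, b, hb⟩ := hA σ hσ α hα hout
  have ha' := ha.symm.trans (h a (mem_univ a))
  have hb' := hb.symm.trans (h b (mem_univ b))
  rcases hj with rfl | rfl
  · simp at hb'
  · simp at ha'

end Outcome

end WaitFree.Algorithm

/-! ### Arithmetic modulo the prime and conclusion -/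

open Polynomial in
/-- A triangular array `a m j`, `j ≤ m ≤ p`, in which every entry of a row is the sum of two
adjacent entries of the next row. -/
theorem ZMod.triangle_apply_eq_add {p : ℕ} [Fact p.Prime] {a : ℕ → ℕ → ZMod p}
    (ha : ∀ m < p, ∀ j ≤ m, a (m + 1) j + a (m + 1) (j + 1) = a m j) :
    a p p = a 0 0 + (-1) ^ p * a p 0 := by
  -- Umbral encoding: `L` sends `X ^ i` to `a i 0`, and moving from column `j` to `j + 1` replaces a
  -- factor `X` by `1 - X`.
  let L : (ZMod p)[X] →ₗ[ZMod p] ZMod p := Polynomial.lsum fun i => LinearMap.mulRight _ (a i 0)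
  have hX : ∀ i, L (X ^ i) = a i 0 := by
    intro i
    simp [L, X_pow_eq_monomial, sum_monomial_index]
  have key : ∀ j m, j ≤ m → m ≤ p → a m j = L (X ^ (m - j) * (1 - X) ^ j) := by
    intro j
    induction j with
    | zero => intro m _ _; simp [hX]
    | succ j ih =>
      intro m hjm hm
      obtain ⟨m, rfl⟩ : ∃ l, m = l + 1 := ⟨m - 1, by omega⟩
      rw [← add_right_inj (a (m + 1) j), ha m hm j (by omega), ih (m + 1) (by omega) hm,
        ih m (by omega) (by omega), ← map_add]
      congr 1
      rw [show m + 1 - j = (m - j) + 1 by omega, show m + 1 - (j + 1) = m - j by omega]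
      ring
  -- Frobenius: `(1 - X) ^ p = 1 + (-1) ^ p * X ^ p`. Keeping the sign as a power covers `p = 2` as
  -- well.
  rw [key p p le_rfl le_rfl, Nat.sub_self, pow_zero, one_mul, sub_eq_add_neg, add_pow_char,
    one_pow, map_add, ← hX 0, ← hX p, pow_zero, neg_pow,
    show ((-1 : (ZMod p)[X]) ^ p) = C ((-1) ^ p) by
      simp only [map_pow, map_neg, map_one], ← smul_eq_C_mul, map_smul, smul_eq_mul]

theorem theorem4 (n : ℕ) (hn : n.Prime) (I : Type u) (𝓘 : Set (WaitFree.InputFun n I))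
    (h𝓘 : WaitFree.NonPrimeDivisibleOrderInvariant 𝓘) :
    ¬ ∃ A : WaitFree.Algorithm.{u, w} n I,
      A.IsWaitFree 𝓘 ∧ A.IsSymmetric 𝓘 ∧ A.SolvesWSB 𝓘 := by
  rintro ⟨A, hwf, hsym, hwsb⟩
  obtain ⟨𝓙, rfl⟩ := h𝓘.finite.exists_finset_coe
  have : Fact n.Prime := ⟨hn⟩
  have hbound : ∀ σ, ∃ k, σ ∈ 𝓙 → WaitFree.Algorithm.StepBound k (A.initial σ) := by
    intro σ
    by_cases hσ : σ ∈ 𝓙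
    · obtain ⟨k, hk⟩ := hwf.exists_stepBound hσ
      exact ⟨k, fun _ => hk⟩
    · exact ⟨0, fun h => absurd h hσ⟩
  choose f hf using hbound
  -- Finiteness of the input set gives one depth for all inputs.
  have hk : ∀ σ ∈ 𝓙, WaitFree.Algorithm.StepBound (𝓙.sup f) (A.initial σ) :=
    fun σ hσ => (hf σ hσ).mono (Finset.le_sup hσ)
  have key := ZMod.triangle_apply_eq_add (p := n)
    (a := fun m j => ((A.thresholdCount 𝓙 (𝓙.sup f) m j : ℤ) : ZMod n)) fun m hm j hj => by
      rw [← Int.cast_add, WaitFree.Algorithm.thresholdCount_add hsym h𝓘.relabel_mem hk hm hj]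
  simp only [WaitFree.Algorithm.thresholdCount_eq_zero hwsb hk (Or.inl rfl),
    WaitFree.Algorithm.thresholdCount_eq_zero hwsb hk (Or.inr rfl),
    WaitFree.Algorithm.thresholdCount_zero] at key
  refine h𝓘.not_dvd hn ?_
  rw [Set.ncard_coe_finset, ← ZMod.natCast_eq_zero_iff]
  simpa using key.symm
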